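/- For a finite group $G$ and a subset $S\subseteq G\setminus\{1\}$ closed under taking inverses, the Cayley graph $C(G,S)$ has vertex set $G$, with $g$ adjacent to $gs$ for all $g\in G$ and $s\in S$; it is regular of degree $|S|$ and has order $|G|$. There exist a strictly increasing sequence of positive integers $d_1<d_2<\dots$ and, for each $i$, a Cayley graph of degree $d_i$, diameter exactly $3$ and order $n_i$ such that $n_i=d_i^3-O(d_i^{5/2})$ as $i\to\infty$. Moreover, let $Cay(d,3)$ denote the largest order of a Cayley graph of degree $d$ and diameter $3$ (for every $d$ the orders of such graphs are bounded; put $Cay(d,3)=0$ if there is no such graph), and let $M(d,3)=1+d+d(d-1)+d(d-1)^2$ be the Moore bound for degree $d$ and diameter $3$. Then $$\limsup_{d\to\infty}\frac{Cay(d,3)}{M(d,3)}=1,$$ that is, the Moore bound for diameter $3$ can be asymptotically approached by Cayley graphs. -/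

import Mathlib

open Filter Asymptotics

/-- The Moore bound `M(d, k) = 1 + d + d (d - 1) + ... + d (d - 1) ^ (k - 1)`. -/
def mooreBound (d k : ℕ) : ℕ :=
  1 + ∑ i ∈ Finset.range k, d * (d - 1) ^ i

/-- The set of orders of Cayley graphs of degree `d` and diameter `k`: the cardinalities of the
finite groups `G` with a subset `S` of size `d`, closed under inverses and not containing `1`,
such that the Cayley graph of `G` with respect to `S` (vertex set `G`, with `g` adjacent to `g * s`
for `s ∈ S`) has diameter exactly `k`. As the (extended) diameter is finite, this graph is
connected, that is, `S` generates `G`. -/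
def cayleyOrders (d k : ℕ) : Set ℕ :=
  {n | ∃ (G : Type) (_ : Group G) (_ : Finite G) (S : Set G),
    (1 : G) ∉ S ∧ (∀ s ∈ S, s⁻¹ ∈ S) ∧ S.ncard = d ∧
    (SimpleGraph.mulCayley S).ediam = (k : ℕ∞) ∧ Nat.card G = n}

/-- `Cay(d, k)`, the largest order of a Cayley graph of degree `d` and diameter `k`. -/
noncomputable def maxCayleyOrder (d k : ℕ) : ℕ :=
  sSup (cayleyOrders d k)

section MooreBound

variable {V : Type*} {Γ : SimpleGraph V}

theorem mooreBound_succ (d k : ℕ) : mooreBound d (k + 1) = mooreBound d k + d * (d - 1) ^ k := by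
  simp [mooreBound, Finset.sum_range_succ, add_assoc]

theorem SimpleGraph.exists_adj_edist_eq_of_edist_eq_succ {v w : V} {k : ℕ}
    (h : Γ.edist v w = (k + 1 : ℕ)) : ∃ u, Γ.Adj u w ∧ Γ.edist v u = k := by
  obtain ⟨p, hp⟩ := Γ.exists_walk_of_edist_eq_coe h
  have hnil : ¬ p.Nil := by
    intro hn
    have := SimpleGraph.Walk.length_eq_zero_iff.mpr hn
    omega
  refine ⟨p.penultimate, p.adj_penultimate hnil, le_antisymm ?_ ?_⟩
  · refine (Γ.edist_le p.dropLast).trans ?_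
    have : p.dropLast.length = k := by
      simp [hp]
    rw [this]
  · have h1 : Γ.edist p.penultimate w ≤ 1 :=
      SimpleGraph.edist_le_one_iff_adj_or_eq.mpr (Or.inl (p.adj_penultimate hnil))
    have h2 : Γ.edist v w ≤ Γ.edist v p.penultimate + 1 :=
      Γ.edist_triangle.trans (by gcongr)
    rw [h, Nat.cast_add, Nat.cast_one] at h2
    exact (ENat.add_le_add_iff_right (by simp)).mp h2

open Classical in
theorem SimpleGraph.card_sphere_succ_le [Fintype V] {d : ℕ} (hd : ∀ v, Γ.degree v ≤ d)
    (v : V) (k : ℕ) :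
    (Finset.univ.filter fun w => Γ.edist v w = (k + 1 : ℕ)).card ≤ d * (d - 1) ^ k := by
  induction k with
  | zero =>
    refine le_trans (Finset.card_le_card ?_) ((hd v).trans (by simp))
    intro w hw
    have hw' : Γ.edist v w = 1 := by simpa using hw
    simpa using SimpleGraph.edist_eq_one_iff_adj.mp hw'
  | succ k ih =>
    have hpar : ∀ g : V, ∃ u, Γ.edist v g = (k + 1 : ℕ) → Γ.Adj u g ∧ Γ.edist v u = k := by
      intro g
      by_cases hg : Γ.edist v g = (k + 1 : ℕ)
      · obtain ⟨u, hu⟩ := SimpleGraph.exists_adj_edist_eq_of_edist_eq_succ hg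
        exact ⟨u, fun _ => hu⟩
      · exact ⟨v, fun h => absurd h hg⟩
    choose par hpar using hpar
    have hsub : (Finset.univ.filter fun w => Γ.edist v w = (k + 1 + 1 : ℕ)) ⊆
        (Finset.univ.filter fun w => Γ.edist v w = (k + 1 : ℕ)).biUnion
          fun g => (Γ.neighborFinset g).erase (par g) := by
      intro w hw
      have hw' : Γ.edist v w = (k + 1 + 1 : ℕ) := by simpa using hw
      obtain ⟨u, hu, hvu⟩ := SimpleGraph.exists_adj_edist_eq_of_edist_eq_succ hw'
      refine Finset.mem_biUnion.mpr ⟨u, by simpa using hvu, Finset.mem_erase.mpr ⟨?_, by simpa⟩⟩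
      rintro rfl
      rw [(hpar u hvu).2] at hw'
      have := Nat.cast_injective (R := ℕ∞) hw'
      omega
    refine (Finset.card_le_card hsub).trans
      ((Finset.card_biUnion_le_card_mul _ _ (d - 1) ?_).trans ?_)
    · intro g hg
      have hg' := hpar g (by simpa using hg)
      rw [Finset.card_erase_of_mem (by simpa using hg'.1.symm)]
      have := hd g
      rw [← SimpleGraph.card_neighborFinset_eq_degree] at this
      omega
    · rw [pow_succ, ← mul_assoc]
      gcongr

open Classical in
theorem SimpleGraph.card_le_mooreBound [Fintype V] [Nonempty V] {d k : ℕ}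
    (hd : ∀ v, Γ.degree v ≤ d) (hk : Γ.ediam ≤ k) : Fintype.card V ≤ mooreBound d k := by
  obtain ⟨v⟩ := ‹Nonempty V›
  have key : ∀ j : ℕ, (Finset.univ.filter fun w => Γ.edist v w ≤ j).card ≤ mooreBound d j := by
    intro j
    induction j with
    | zero =>
      have : (Finset.univ.filter fun w => Γ.edist v w ≤ (0 : ℕ)) = {v} := by
        ext w
        simp [eq_comm (a := w)]
      rw [this]
      simp [mooreBound]
    | succ j ih =>
      rw [mooreBound_succ]
      refine le_trans (Finset.card_le_card ?_) ((Finset.card_union_le _ _).trans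
        (add_le_add ih (Γ.card_sphere_succ_le hd v j)))
      intro w hw
      have hw' : Γ.edist v w ≤ (j + 1 : ℕ) := by simpa using hw
      rcases hw'.lt_or_eq with h | h
      · refine Finset.mem_union_left _ ?_
        simpa using Order.le_of_lt_add_one (by simpa using h)
      · exact Finset.mem_union_right _ (by simpa using h)
  refine le_trans (le_of_eq ?_) (key k)
  rw [Finset.filter_true_of_mem, Finset.card_univ]
  intro w _
  exact SimpleGraph.edist_le_ediam.trans hk

end MooreBound

section Cayley

variable {G : Type*} [Group G] {S : Set G}

theorem mulCayley_adj_of_inv (h1 : (1 : G) ∉ S) (hinv : ∀ s ∈ S, s⁻¹ ∈ S) {u v : G} :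
    (SimpleGraph.mulCayley S).Adj u v ↔ u⁻¹ * v ∈ S := by
  rw [SimpleGraph.mulCayley_adj']
  constructor
  · rintro ⟨-, g, hg, rfl | rfl⟩
    · simpa
    · simpa using hinv g hg
  · intro h
    refine ⟨?_, _, h, Or.inl (by simp)⟩
    rintro rfl
    simp [h1] at h

theorem natCard_le_mooreBound [Finite G] (h1 : (1 : G) ∉ S) (hinv : ∀ s ∈ S, s⁻¹ ∈ S) {k : ℕ}
    (hk : (SimpleGraph.mulCayley S).ediam ≤ k) : Nat.card G ≤ mooreBound S.ncard k := by
  classical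
  have := Fintype.ofFinite G
  rw [Nat.card_eq_fintype_card]
  refine SimpleGraph.card_le_mooreBound (fun v => le_of_eq ?_) hk
  rw [← SimpleGraph.card_neighborFinset_eq_degree, ← Set.ncard_coe_finset,
    SimpleGraph.coe_neighborFinset]
  have : (SimpleGraph.mulCayley S).neighborSet v = (fun x => v * x) '' S := by
    ext w
    rw [SimpleGraph.mem_neighborSet, mulCayley_adj_of_inv h1 hinv]
    constructor
    · exact fun h => ⟨_, h, by simp⟩
    · rintro ⟨x, hx, rfl⟩
      simpa
  rw [this, Set.ncard_image_of_injective _ (mul_right_injective v)]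

theorem ediam_mulCayley_le_three (h1 : (1 : G) ∉ S) (hinv : ∀ s ∈ S, s⁻¹ ∈ S)
    (h : ∀ g : G, ∃ x ∈ insert 1 S, ∃ y ∈ insert 1 S, ∃ z ∈ insert 1 S, g = x * y * z) :
    (SimpleGraph.mulCayley S).ediam ≤ 3 := by
  have step : ∀ u x : G, x ∈ insert 1 S → (SimpleGraph.mulCayley S).edist u (u * x) ≤ 1 := by
    intro u x hx
    rw [SimpleGraph.edist_le_one_iff_adj_or_eq, mulCayley_adj_of_inv h1 hinv]
    rcases hx with rfl | hx
    · simp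
    · simp [hx]
  refine SimpleGraph.ediam_le_of_edist_le fun u v => ?_
  obtain ⟨x, hx, y, hy, z, hz, hg⟩ := h (u⁻¹ * v)
  have hv : v = u * x * y * z := by
    rw [mul_assoc u, mul_assoc u, ← hg]
    simp
  rw [hv]
  calc _ ≤ _ := SimpleGraph.edist_triangle (v := u * x * y)
    _ ≤ (_ + _) + _ := by gcongr; exact SimpleGraph.edist_triangle (v := u * x)
    _ ≤ (1 + 1) + 1 := by gcongr <;> exact step _ _ ‹_›
    _ = 3 := by norm_num

theorem mem_cayleyOrders_three {G : Type} [Group G] [Finite G] {S : Set G} (h1 : (1 : G) ∉ S)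
    (hinv : ∀ s ∈ S, s⁻¹ ∈ S)
    (h : ∀ g : G, ∃ x ∈ insert 1 S, ∃ y ∈ insert 1 S, ∃ z ∈ insert 1 S, g = x * y * z)
    (hlarge : mooreBound S.ncard 2 < Nat.card G) : Nat.card G ∈ cayleyOrders S.ncard 3 := by
  refine ⟨G, inferInstance, inferInstance, S, h1, hinv, rfl, ?_, rfl⟩
  refine le_antisymm (ediam_mulCayley_le_three h1 hinv h) ?_
  by_contra hlt
  rw [not_le] at hlt
  have h2 : (SimpleGraph.mulCayley S).ediam ≤ (2 : ℕ) :=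
    Order.le_of_lt_add_one (by simpa [← one_add_one_eq_two, ← two_add_one_eq_three] using hlt)
  exact absurd (natCard_le_mooreBound h1 hinv h2) (not_le.mpr hlarge)

end Cayley

theorem le_mooreBound_of_mem_cayleyOrders {d k n : ℕ} (h : n ∈ cayleyOrders d k) :
    n ≤ mooreBound d k := by
  obtain ⟨G, _, _, S, h1, hinv, rfl, hd, rfl⟩ := h
  exact natCard_le_mooreBound h1 hinv hd.le

theorem bddAbove_cayleyOrders (d k : ℕ) : BddAbove (cayleyOrders d k) :=
  ⟨mooreBound d k, fun _ => le_mooreBound_of_mem_cayleyOrders⟩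

theorem maxCayleyOrder_le_mooreBound (d k : ℕ) : maxCayleyOrder d k ≤ mooreBound d k := by
  rcases (cayleyOrders d k).eq_empty_or_nonempty with h | h
  · simp [maxCayleyOrder, h]
  · exact csSup_le h fun _ => le_mooreBound_of_mem_cayleyOrders

theorem exists_symm_mul_self_eq {H : Type*} [Group H] [Finite H] [IsCyclic H] :
    ∃ A : Set H, A.ncard ≤ 4 * (Nat.sqrt (Nat.card H) + 1) ∧ (∀ x ∈ A, x⁻¹ ∈ A) ∧
      ∀ h, ∃ x ∈ A, ∃ y ∈ A, h = x * y := by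
  classical
  obtain ⟨g, hg⟩ := IsCyclic.exists_generator (α := H)
  set m := Nat.sqrt (Nat.card H) + 1
  let B : Finset H := (Finset.range m).image (fun i => g ^ i) ∪
    (Finset.range m).image (fun i => g ^ (m * i))
  have hB : B.card ≤ m + m := (Finset.card_union_le _ _).trans
    (add_le_add (Finset.card_image_le.trans (by simp)) (Finset.card_image_le.trans (by simp)))
  refine ⟨((B ∪ B.image (·⁻¹) : Finset H) : Set H), ?_, ?_, ?_⟩
  · rw [Set.ncard_coe_finset]
    have := Finset.card_union_le B (B.image (·⁻¹))
    have : (B.image (·⁻¹)).card ≤ B.card := Finset.card_image_le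
    omega
  · intro x hx
    simp only [Finset.coe_union, Finset.coe_image, Set.mem_union, Set.mem_image,
      Finset.mem_coe] at hx ⊢
    rcases hx with h | ⟨y, hy, rfl⟩
    · exact Or.inr ⟨x, h, rfl⟩
    · exact Or.inl (by simpa)
  · intro h
    obtain ⟨k, hk, rfl⟩ := Finset.mem_image.mp
      (mem_zpowers_iff_mem_range_orderOf.mp (hg h))
    rw [Finset.mem_range] at hk
    have hlt : k < m * m := lt_of_lt_of_le hk
      ((orderOf_le_card (x := g)).trans (Nat.lt_succ_sqrt _).le)
    refine ⟨g ^ (k % m), Finset.mem_coe.mpr (Finset.mem_union_left _ (Finset.mem_union_left _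
        (Finset.mem_image.mpr ⟨_, Finset.mem_range.mpr (Nat.mod_lt _ (Nat.succ_pos _)), rfl⟩))),
      g ^ (m * (k / m)), Finset.mem_coe.mpr (Finset.mem_union_left _ (Finset.mem_union_right _
        (Finset.mem_image.mpr ⟨_, Finset.mem_range.mpr (Nat.div_lt_of_lt_mul hlt), rfl⟩))), ?_⟩
    rw [← pow_add, Nat.mod_add_div]

section

variable {F : Type*} [Field F]

/-- The group of triples `(u, w, s)` with the multiplication
`(u, w, s) (a, e, r) = (u + s a, w + σ(s) s e + s σ(u) a, s r)`. If `F` is finite of characteristic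
two and `σ ^ 2` is the Frobenius map, it is a point stabilizer in the Suzuki group of `F`; `fst` and
`snd` describe the unipotent part and `tor` the torus part. -/
@[ext]
structure SuzukiBorel (σ : F →+* F) where
  fst : F
  snd : F
  tor : Fˣ

namespace SuzukiBorel

variable {σ : F →+* F}

instance : Mul (SuzukiBorel σ) :=
  ⟨fun g h => ⟨g.fst + g.tor * h.fst,
    g.snd + σ g.tor * g.tor * h.snd + g.tor * σ g.fst * h.fst, g.tor * h.tor⟩⟩

instance : One (SuzukiBorel σ) := ⟨⟨0, 0, 1⟩⟩

instance : Inv (SuzukiBorel σ) :=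
  ⟨fun g => ⟨-(g.tor⁻¹ : Fˣ) * g.fst,
    (g.tor⁻¹ : Fˣ) * σ (g.tor⁻¹ : Fˣ) * (σ g.fst * g.fst - g.snd), g.tor⁻¹⟩⟩

@[simp] theorem mul_fst (g h : SuzukiBorel σ) : (g * h).fst = g.fst + g.tor * h.fst := rfl

@[simp] theorem mul_snd (g h : SuzukiBorel σ) : (g * h).snd =
    g.snd + σ g.tor * g.tor * h.snd + g.tor * σ g.fst * h.fst := rfl

@[simp] theorem mul_tor (g h : SuzukiBorel σ) : (g * h).tor = g.tor * h.tor := rfl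

@[simp] theorem one_fst : (1 : SuzukiBorel σ).fst = 0 := rfl

@[simp] theorem one_snd : (1 : SuzukiBorel σ).snd = 0 := rfl

@[simp] theorem one_tor : (1 : SuzukiBorel σ).tor = 1 := rfl

@[simp] theorem inv_fst (g : SuzukiBorel σ) : (g⁻¹).fst = -(g.tor⁻¹ : Fˣ) * g.fst := rfl

@[simp] theorem inv_snd (g : SuzukiBorel σ) : (g⁻¹).snd =
    (g.tor⁻¹ : Fˣ) * σ (g.tor⁻¹ : Fˣ) * (σ g.fst * g.fst - g.snd) := rfl

@[simp] theorem inv_tor (g : SuzukiBorel σ) : (g⁻¹).tor = g.tor⁻¹ := rfl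

instance : Group (SuzukiBorel σ) :=
  Group.ofLeftAxioms
    (by
      intro a b c
      ext
      · simp; ring
      · simp; ring
      · simp [mul_assoc])
    (by intro a; ext <;> simp)
    (by
      intro a
      ext
      · simp
      · simp
        ring
      · simp)


/-- The elements that take a fixed non-absolute point of the symplectic quadrangle to a point on
its polar line. -/
def polarSet (σ : F →+* F) : Set (SuzukiBorel σ) :=
  {g | g.snd = 1 ∧ σ g.tor * g.tor = 1 + σ g.fst * g.fst}

/-- The diagonal torus. -/
def diagTorus (σ : F →+* F) : Fˣ →* SuzukiBorel σ where
  toFun s := ⟨0, 0, s⟩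
  map_one' := rfl
  map_mul' s t := by ext <;> simp

/-- A conjugate of the diagonal torus: the stabilizer of the absolute point that is adjacent to the
base point of `polarSet`. -/
def polarTorus [CharP F 2] (σ : F →+* F) : Fˣ →* SuzukiBorel σ where
  toFun s := ⟨1 + s, 1 + s, s⟩
  map_one' := by ext <;> simp [CharTwo.add_self_eq_zero]
  map_mul' s t := by
    have h2 : (2 : F) = 0 := CharTwo.two_eq_zero
    ext
    · simp
      linear_combination (-(s : F)) * h2
    · simp
      linear_combination (-(s : F) - σ s * s - σ s * s * t) * h2
    · simp

theorem eq_of_map_mul_self_eq (hσ : ∀ x, σ (σ x) = x ^ 2) {x y : F} (h : σ x * x = σ y * y) : x = y := by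
  rcases eq_or_ne y 0 with rfl | hy
  · simpa using h
  · have hy' : σ y ≠ 0 := (map_ne_zero σ).mpr hy
    have hz : σ (x / y) * (x / y) = 1 := by
      rw [map_div₀]
      field_simp
      exact h
    have hz' := congrArg σ hz
    rw [map_mul, hσ, map_one] at hz'
    have : x / y = 1 := by linear_combination hz' - (x / y) * hz
    exact (div_eq_one_iff_eq hy).mp this

theorem exists_map_mul_self_eq (hσ : ∀ x, σ (σ x) = x ^ 2) {x : F} (hx : x ≠ 0) : ∃ s : Fˣ, σ s * s = x := by
  have hx' : σ x ≠ 0 := (map_ne_zero σ).mpr hx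
  refine ⟨Units.mk0 (σ x / x) (div_ne_zero hx' hx), ?_⟩
  rw [Units.val_mk0, map_div₀, hσ]
  field_simp

theorem fst_injOn_polarSet (hσ : ∀ x, σ (σ x) = x ^ 2) : Set.InjOn SuzukiBorel.fst (polarSet σ) := by
  intro g hg h hh e
  refine SuzukiBorel.ext e (hg.1.trans hh.1.symm) (Units.ext (eq_of_map_mul_self_eq hσ ?_))
  rw [hg.2, hh.2, e]

theorem ncard_polarSet_le (hσ : ∀ x, σ (σ x) = x ^ 2) [Finite F] : (polarSet σ).ncard ≤ Nat.card F := by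
  rw [← Set.ncard_univ]
  exact Set.ncard_le_ncard_of_injOn SuzukiBorel.fst (fun _ _ => Set.mem_univ _)
    (fst_injOn_polarSet hσ)

variable [CharP F 2]

theorem inv_mul_mem_polarSet_iff {g h : SuzukiBorel σ} : g⁻¹ * h ∈ polarSet σ ↔
    h.snd = σ g.tor * g.tor + g.snd + σ g.fst * g.fst + σ g.fst * h.fst ∧
      σ h.tor * h.tor = σ g.tor * g.tor + σ (g.fst + h.fst) * (g.fst + h.fst) := by
  have h2 : (2 : F) = 0 := CharTwo.two_eq_zero
  obtain ⟨k, rfl⟩ : ∃ k, h = g * k := ⟨g⁻¹ * h, by simp⟩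
  have hs : (g.tor : F) ≠ 0 := g.tor.ne_zero
  have hs' : σ g.tor * (g.tor : F) ≠ 0 := mul_ne_zero ((map_ne_zero σ).mpr hs) hs
  rw [inv_mul_cancel_left]
  simp only [polarSet, Set.mem_ofPred_eq, mul_fst, mul_snd, mul_tor, Units.val_mul, map_mul, map_add]
  refine and_congr ⟨fun h => ?_, fun h => ?_⟩ ⟨fun h => ?_, fun h => ?_⟩
  · rw [h]
    linear_combination (-σ g.fst * g.fst) * h2
  · refine mul_left_cancel₀ hs' ?_
    linear_combination h + (σ g.fst * g.fst) * h2
  · linear_combination (σ g.tor * g.tor) * h - (2 * σ g.fst * g.fst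
      + σ g.fst * (g.tor * k.fst) + σ g.tor * σ k.fst * g.fst) * h2
  · refine mul_left_cancel₀ hs' ?_
    linear_combination h + (2 * σ g.fst * g.fst + σ g.fst * (g.tor * k.fst)
      + σ g.tor * σ k.fst * g.fst) * h2

theorem inv_mem_polarSet {g : SuzukiBorel σ} (hg : g ∈ polarSet σ) : g⁻¹ ∈ polarSet σ := by
  have h2 : (2 : F) = 0 := CharTwo.two_eq_zero
  rw [← mul_one g⁻¹, inv_mul_mem_polarSet_iff]
  obtain ⟨h1, h3⟩ := hg
  simp only [one_snd, one_fst, one_tor, h1, h3, Units.val_one, map_one, add_zero,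
    mul_zero, mul_one]
  constructor <;> grind

/-- The element `(1, 1, 1)`. -/
def oneOneOne (σ : F →+* F) : SuzukiBorel σ := ⟨1, 1, 1⟩

theorem exists_factorization_of_snd_eq_one (hσ : ∀ x, σ (σ x) = x ^ 2) {g : SuzukiBorel σ}
    (hg : g.snd = 1) :
    (∃ t, g = oneOneOne σ * diagTorus σ t) ∨ ∃ s ∈ polarSet σ, ∃ t, g = s * diagTorus σ t := by
  have h2 : (2 : F) = 0 := CharTwo.two_eq_zero
  rcases eq_or_ne (1 + σ g.fst * g.fst) 0 with h | h
  · refine Or.inl ⟨g.tor, ?_⟩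
    have : g.fst = 1 := eq_of_map_mul_self_eq hσ (by
      rw [map_one]
      linear_combination h - h2)
    ext <;> simp [oneOneOne, diagTorus, this, hg]
  · obtain ⟨r, hr⟩ := exists_map_mul_self_eq hσ h
    refine Or.inr ⟨⟨g.fst, 1, r⟩, ⟨rfl, hr⟩, r⁻¹ * g.tor, ?_⟩
    ext <;> simp [diagTorus, hg]

theorem exists_factorization_of_eq (hσ : ∀ x, σ (σ x) = x ^ 2) {g : SuzukiBorel σ} {u v : F}
    (h1 : g.snd + 1 = u * σ v)
    (h3 : σ g.tor * g.tor + g.snd + σ g.fst * g.fst = σ u * v) :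
    (∃ t, g = polarTorus σ t) ∨ (∃ t, ∃ s ∈ polarSet σ, g = polarTorus σ t * s) ∨
      (∃ s ∈ polarSet σ, ∃ t, g = s * polarTorus σ t) ∨
      ∃ x ∈ polarSet σ, ∃ y ∈ polarSet σ, ∃ z ∈ polarSet σ, g = x * y * z := by
  have h2 : (2 : F) = 0 := CharTwo.two_eq_zero
  obtain ⟨a, e, s⟩ := g
  simp only at h1 h3
  rcases eq_or_ne (1 + σ (u + a) * (u + a)) 0 with hc | hc
  · have hu : u = 1 + a := by
      have : u + a = 1 := eq_of_map_mul_self_eq hσ (by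
        rw [map_one]
        linear_combination hc - h2)
      linear_combination this - a * h2
    subst hu
    simp only [map_add, map_one] at h1 h3 hc
    rcases eq_or_ne (1 + v) 0 with hv | hv
    · have hv : v = 1 := by linear_combination hv - h2
      subst hv
      refine Or.inl ⟨s, ?_⟩
      have hs : (s : F) = 1 + a := eq_of_map_mul_self_eq hσ (by
        simp only [map_add, map_one] at h1 ⊢
        grind)
      ext
      · simp only [polarTorus, MonoidHom.coe_mk, OneHom.coe_mk]
        grind
      · simp only [polarTorus, MonoidHom.coe_mk, OneHom.coe_mk]
        simp only [map_one] at h1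
        grind
      · rfl
    · refine Or.inr (Or.inl ⟨Units.mk0 _ hv, (polarTorus σ (Units.mk0 _ hv))⁻¹ * ⟨a, e, s⟩, ?_,
        by simp⟩)
      rw [inv_mul_mem_polarSet_iff]
      simp only [polarTorus, MonoidHom.coe_mk, OneHom.coe_mk, Units.val_mk0, map_add, map_one]
      constructor <;> grind
  · obtain ⟨r, hr⟩ := exists_map_mul_self_eq hσ hc
    rcases eq_or_ne (1 + σ (u + a) * (u + a) + σ (u + a + v) * (u + a + v)) 0 with hd | hd
    · have hr' : (r : F) = u + a + v := eq_of_map_mul_self_eq hσ (by grind)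
      have hs : (s : F) = v + a := eq_of_map_mul_self_eq hσ (by
        simp only [map_add] at *
        grind)
      refine Or.inr (Or.inr (Or.inl ⟨⟨u + a, 1, r⟩, ⟨rfl, hr⟩, r⁻¹ * s, ?_⟩))
      ext
      · simp only [polarTorus, MonoidHom.coe_mk, OneHom.coe_mk, mul_fst, mul_add, mul_one,
          Units.val_mul, Units.mul_inv_cancel_left]
        grind
      · simp only [polarTorus, MonoidHom.coe_mk, OneHom.coe_mk, mul_snd, mul_add, mul_one,
          Units.val_mul]
        have h4 : (r : F) * ((r⁻¹ : Fˣ) * s) = s := by simp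
        simp only [map_add] at *
        have h5 : σ r * r * ((r⁻¹ : Fˣ) * s) = σ r * s := by rw [mul_assoc, h4]
        have h6 : (r : F) * (σ u + σ a) * ((r⁻¹ : Fˣ) * s) = (σ u + σ a) * s := by
          rw [mul_comm (r : F), mul_assoc, h4]
        have h7 : σ r = σ u + σ a + σ v := by rw [hr']; simp
        grind
      · simp [polarTorus]
    · obtain ⟨p, hp⟩ := exists_map_mul_self_eq hσ hd
      refine Or.inr (Or.inr (Or.inr ⟨⟨u + a, 1, r⟩, ⟨rfl, hr⟩,
        (⟨u + a, 1, r⟩ : SuzukiBorel σ)⁻¹ * ⟨v, σ (u + a) * v, p⟩, ?_,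
        (⟨v, σ (u + a) * v, p⟩ : SuzukiBorel σ)⁻¹ * ⟨a, e, s⟩, ?_, by simp⟩))
      · rw [inv_mul_mem_polarSet_iff]
        simp only [map_add] at *
        constructor <;> grind
      · rw [inv_mul_mem_polarSet_iff]
        simp only [map_add] at *
        constructor <;> grind

/-- The elements that have one of the factorizations used to bound the diameter. -/
def Factors (g : SuzukiBorel σ) : Prop :=
  (∃ t, g = oneOneOne σ * diagTorus σ t) ∨ (∃ s ∈ polarSet σ, ∃ t, g = s * diagTorus σ t) ∨
  (∃ t, g = polarTorus σ t) ∨ (∃ t, ∃ s ∈ polarSet σ, g = polarTorus σ t * s) ∨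
  (∃ s ∈ polarSet σ, ∃ t, g = s * polarTorus σ t) ∨
  ∃ x ∈ polarSet σ, ∃ y ∈ polarSet σ, ∃ z ∈ polarSet σ, g = x * y * z

theorem factors_or_factors_inv (hσ : ∀ x, σ (σ x) = x ^ 2) (g : SuzukiBorel σ) :
    Factors g ∨ Factors g⁻¹ := by
  have h2 : (2 : F) = 0 := CharTwo.two_eq_zero
  rcases eq_or_ne g.snd 1 with h1 | h1
  · left
    rcases exists_factorization_of_snd_eq_one hσ h1 with h | h
    exacts [Or.inl h, Or.inr (Or.inl h)]
  rcases eq_or_ne (σ g.tor * g.tor + g.snd + σ g.fst * g.fst) 0 with h3 | h3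
  · right
    have : (g⁻¹).snd = 1 := by
      have hs : (g.tor : F) ≠ 0 := g.tor.ne_zero
      have hs' : σ (g.tor : F) ≠ 0 := by simp
      rw [inv_snd, Units.val_inv_eq_inv_val, map_inv₀]
      field_simp
      linear_combination h3 - (g.snd + σ g.tor * g.tor) * h2
    rcases exists_factorization_of_snd_eq_one hσ this with h | h
    exacts [Or.inl h, Or.inr (Or.inl h)]
  · left
    have h1' : g.snd + 1 ≠ 0 := fun h => h1 (by linear_combination h - h2)
    have h4 : σ (g.snd + 1) ≠ 0 := (map_ne_zero σ).mpr h1'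
    have h5 : σ (σ g.tor * g.tor + g.snd + σ g.fst * g.fst) ≠ 0 := (map_ne_zero σ).mpr h3
    refine Or.inr (Or.inr (exists_factorization_of_eq hσ
      (u := σ (σ g.tor * g.tor + g.snd + σ g.fst * g.fst) / (g.snd + 1))
      (v := σ (g.snd + 1) / (σ g.tor * g.tor + g.snd + σ g.fst * g.fst)) ?_ ?_))
    · rw [map_div₀, hσ]
      generalize σ g.tor * g.tor + g.snd + σ g.fst * g.fst = b at *
      field_simp
    · rw [map_div₀, hσ]
      generalize σ g.tor * g.tor + g.snd + σ g.fst * g.fst = b at *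
      field_simp

end SuzukiBorel

end

namespace SuzukiBorel

variable {F : Type*} [Field F] {σ : F →+* F}

/-- The coordinates of an element, as an equivalence. -/
def equivProd (σ : F →+* F) : SuzukiBorel σ ≃ F × F × Fˣ where
  toFun g := (g.fst, g.snd, g.tor)
  invFun p := ⟨p.1, p.2.1, p.2.2⟩

instance [Finite F] : Finite (SuzukiBorel σ) := Finite.of_equiv _ (equivProd σ).symm

theorem natCard_eq [Finite F] (σ : F →+* F) :
    Nat.card (SuzukiBorel σ) = Nat.card F ^ 2 * (Nat.card F - 1) := by
  rw [Nat.card_congr (equivProd σ), Nat.card_prod, Nat.card_prod, Nat.card_units]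
  ring

theorem exists_connectionSet [CharP F 2] [Finite F] (hσ : ∀ x, σ (σ x) = x ^ 2) :
    ∃ S : Set (SuzukiBorel σ), (1 : SuzukiBorel σ) ∉ S ∧ (∀ s ∈ S, s⁻¹ ∈ S) ∧
      S.ncard ≤ Nat.card F + 8 * Nat.sqrt (Nat.card F) + 10 ∧
      ∀ g, ∃ x ∈ insert 1 S, ∃ y ∈ insert 1 S, ∃ z ∈ insert 1 S, g = x * y * z := by
  obtain ⟨A, hAcard, hAinv, hA⟩ := exists_symm_mul_self_eq (H := Fˣ)
  set U : Set (SuzukiBorel σ) := polarSet σ ∪ (diagTorus σ '' A ∪ polarTorus σ '' A) ∪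
    {oneOneOne σ, (oneOneOne σ)⁻¹} with hU
  have hUinv : ∀ s ∈ U, s⁻¹ ∈ U := by
    rintro s ((h | (⟨a, ha, rfl⟩ | ⟨a, ha, rfl⟩)) | rfl | rfl)
    · exact Or.inl (Or.inl (inv_mem_polarSet h))
    · exact Or.inl (Or.inr (Or.inl ⟨a⁻¹, hAinv a ha, map_inv _ _⟩))
    · exact Or.inl (Or.inr (Or.inr ⟨a⁻¹, hAinv a ha, map_inv _ _⟩))
    · exact Or.inr (Or.inr rfl)
    · exact Or.inr (Or.inl (inv_inv _))
  have hS : ∀ x ∈ polarSet σ, x ∈ insert 1 U := fun x hx => Or.inr (Or.inl (Or.inl hx))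
  have hT : ∀ a ∈ A, diagTorus σ a ∈ insert 1 U :=
    fun a ha => Or.inr (Or.inl (Or.inr (Or.inl ⟨a, ha, rfl⟩)))
  have hY : ∀ a ∈ A, polarTorus σ a ∈ insert 1 U :=
    fun a ha => Or.inr (Or.inl (Or.inr (Or.inr ⟨a, ha, rfl⟩)))
  have hx : oneOneOne σ ∈ insert 1 U := Or.inr (Or.inr (Or.inl rfl))
  have hfac : ∀ g : SuzukiBorel σ, Factors g →
      ∃ x ∈ insert 1 U, ∃ y ∈ insert 1 U, ∃ z ∈ insert 1 U, g = x * y * z := by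
    rintro g (⟨t, rfl⟩ | ⟨s, hs, t, rfl⟩ | ⟨t, rfl⟩ | ⟨t, s, hs, rfl⟩ | ⟨s, hs, t, rfl⟩ |
      ⟨x, hx, y, hy, z, hz, rfl⟩)
    · obtain ⟨a, ha, b, hb, rfl⟩ := hA t
      exact ⟨_, hx, _, hT a ha, _, hT b hb, by rw [map_mul, mul_assoc]⟩
    · obtain ⟨a, ha, b, hb, rfl⟩ := hA t
      exact ⟨_, hS s hs, _, hT a ha, _, hT b hb, by rw [map_mul, mul_assoc]⟩
    · obtain ⟨a, ha, b, hb, rfl⟩ := hA t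
      exact ⟨1, Or.inl rfl, _, hY a ha, _, hY b hb, by rw [map_mul, one_mul]⟩
    · obtain ⟨a, ha, b, hb, rfl⟩ := hA t
      exact ⟨_, hY a ha, _, hY b hb, _, hS s hs, by rw [map_mul]⟩
    · obtain ⟨a, ha, b, hb, rfl⟩ := hA t
      exact ⟨_, hS s hs, _, hY a ha, _, hY b hb, by rw [map_mul, mul_assoc]⟩
    · exact ⟨_, hS x hx, _, hS y hy, _, hS z hz, rfl⟩
  have hinv' : ∀ s ∈ insert 1 U, s⁻¹ ∈ insert 1 U := by
    rintro s (rfl | hs)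
    · exact Or.inl inv_one
    · exact Or.inr (hUinv s hs)
  refine ⟨U \ {1}, fun h => h.2 rfl, fun s hs => ⟨hUinv s hs.1, fun h => hs.2 ?_⟩, ?_, ?_⟩
  · simpa using h
  · have h1 := Set.ncard_sdiff_singleton_le U 1
    have h2 := Set.ncard_union_le (polarSet σ ∪ (diagTorus σ '' A ∪ polarTorus σ '' A))
      {oneOneOne σ, (oneOneOne σ)⁻¹}
    rw [← hU] at h2
    have h3 := Set.ncard_union_le (polarSet σ) (diagTorus σ '' A ∪ polarTorus σ '' A)
    have h4 := Set.ncard_union_le (diagTorus σ '' A) (polarTorus σ '' A)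
    have h5 := Set.ncard_image_le (f := diagTorus σ) A.toFinite
    have h6 := Set.ncard_image_le (f := polarTorus σ) A.toFinite
    have h7 := ncard_polarSet_le hσ
    have h8 : ({oneOneOne σ, (oneOneOne σ)⁻¹} : Set (SuzukiBorel σ)).ncard ≤ 2 :=
      (Set.ncard_insert_le _ _).trans (by simp)
    have h9 : Nat.sqrt (Nat.card Fˣ) ≤ Nat.sqrt (Nat.card F) :=
      Nat.sqrt_le_sqrt (by rw [Nat.card_units]; omega)
    omega
  · rw [Set.insert_sdiff_singleton]
    intro g
    rcases factors_or_factors_inv hσ g with h | h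
    · exact hfac g h
    · obtain ⟨x, hx, y, hy, z, hz, hg⟩ := hfac _ h
      refine ⟨_, hinv' z hz, _, hinv' y hy, _, hinv' x hx, ?_⟩
      rw [← inv_inv g, hg]
      simp [mul_assoc]

end SuzukiBorel

theorem mooreBound_two_le (d : ℕ) : mooreBound d 2 ≤ d ^ 2 + 1 := by
  rcases d with _ | d
  · simp [mooreBound]
  · simp only [mooreBound, Finset.sum_range_succ, Finset.sum_range_zero, Nat.add_sub_cancel]
    nlinarith

theorem exists_mem_cayleyOrders_three {q : ℕ} (hq : ∃ m, 5 ≤ m ∧ q = 2 ^ (2 * m + 1)) :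
    ∃ d ≤ q + 8 * Nat.sqrt q + 10, q ^ 2 * (q - 1) ∈ cayleyOrders d 3 := by
  obtain ⟨m, hm, hq⟩ := hq
  let F := GaloisField 2 (2 * m + 1)
  have hcard : Nat.card F = q := by rw [GaloisField.card _ _ (by omega), hq]
  have hσ : ∀ x : F, iterateFrobenius F 2 (m + 1) (iterateFrobenius F 2 (m + 1) x) = x ^ 2 := by
    intro x
    have : Fintype F := Fintype.ofFinite F
    have hx : x ^ 2 ^ (2 * m + 1) = x := by
      rw [← hq, ← hcard, Nat.card_eq_fintype_card, FiniteField.pow_card]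
    rw [iterateFrobenius_def, iterateFrobenius_def, ← pow_mul, ← pow_add,
      show m + 1 + (m + 1) = (2 * m + 1) + 1 by ring, pow_succ 2 (2 * m + 1), pow_mul, hx]
  obtain ⟨S, h1, hinv, hS, hfac⟩ := SuzukiBorel.exists_connectionSet hσ
  rw [hcard] at hS
  have hn := SuzukiBorel.natCard_eq (iterateFrobenius F 2 (m + 1))
  rw [hcard] at hn
  refine ⟨S.ncard, hS, ?_⟩
  rw [← hn]
  refine mem_cayleyOrders_three h1 hinv hfac ((mooreBound_two_le _).trans_lt ?_)
  have hq' : 2 ^ 11 ≤ q := hq ▸ Nat.pow_le_pow_right (by norm_num) (by omega)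
  have h19 : S.ncard ≤ 19 * q := by
    have := Nat.sqrt_le_self q
    omega
  rw [hn]
  calc S.ncard ^ 2 + 1 ≤ (19 * q) ^ 2 + 1 := by gcongr
    _ < q ^ 2 * 362 := by nlinarith
    _ ≤ q ^ 2 * (q - 1) := by gcongr; omega

theorem mooreBound_three_cast (d : ℕ) : (mooreBound d 3 : ℝ) = d ^ 3 - d ^ 2 + d + 1 := by
  rcases d with _ | d
  · simp [mooreBound]
  · simp only [mooreBound, Finset.sum_range_succ, Finset.sum_range_zero, Nat.add_sub_cancel]
    push_cast
    ring

theorem exists_cayleyOrders_three_asymptotic :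
    ∃ d n : ℕ → ℕ, ∃ C : ℝ, StrictMono d ∧ (∀ i, n i ∈ cayleyOrders (d i) 3) ∧
      ∀ i, ‖(d i : ℝ) ^ 3 - (n i : ℝ)‖ ≤ C * ‖(d i : ℝ) ^ (5 / 2 : ℝ)‖ := by
  let q : ℕ → ℕ := fun i => 2 ^ (2 * (i + 5) + 1)
  choose d hd hmem using fun i =>
    exists_mem_cayleyOrders_three (q := q i) ⟨i + 5, by omega, rfl⟩
  have hq1 : ∀ i, 2 ≤ q i := fun i => by
    have : 2 ^ 1 ≤ q i := Nat.pow_le_pow_right (by norm_num) (by omega)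
    simpa using this
  have hn : ∀ i, ((q i ^ 2 * (q i - 1) : ℕ) : ℝ) = (q i : ℝ) ^ 3 - (q i : ℝ) ^ 2 := fun i => by
    rw [Nat.cast_mul, Nat.cast_sub (by have := hq1 i; omega)]
    push_cast
    ring
  have hM : ∀ i, (q i : ℝ) ^ 3 - (q i : ℝ) ^ 2 ≤ (d i : ℝ) ^ 3 - (d i : ℝ) ^ 2 + d i + 1 :=
    fun i => by
      rw [← hn, ← mooreBound_three_cast]
      exact_mod_cast le_mooreBound_of_mem_cayleyOrders (hmem i)
  have hd1 : ∀ i, 1 ≤ d i := fun i => by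
    by_contra h0
    have h0 : d i = 0 := by omega
    have := hM i
    have h2 : (2 : ℝ) ≤ q i := by exact_mod_cast hq1 i
    rw [h0] at this
    norm_num at this
    nlinarith
  have hq2 : ∀ i, (q i : ℝ) ≤ 2 * d i := fun i => by
    by_contra hlt
    rw [not_le] at hlt
    have h2 : (2 : ℝ) ≤ q i := by exact_mod_cast hq1 i
    have hd' : (1 : ℝ) ≤ d i := by exact_mod_cast hd1 i
    have h3 := hM i
    have h4 : (d i : ℝ) ^ 3 ≤ (q i / 2 : ℝ) ^ 3 := by gcongr; linarith
    nlinarith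
  have htend : Tendsto d atTop atTop := by
    refine tendsto_atTop_mono (f := fun i => i) (fun i => ?_) tendsto_id
    have h1 : q i ≤ 2 * d i := by exact_mod_cast hq2 i
    have h2 : 2 * i < q i := (by omega : 2 * i < 2 * (i + 5) + 1).trans Nat.lt_two_pow_self
    omega
  obtain ⟨φ, hφ, hφd⟩ := strictMono_subseq_of_tendsto_atTop htend
  refine ⟨d ∘ φ, fun i => q (φ i) ^ 2 * (q (φ i) - 1), 6859 * 32, hφd, fun i => hmem _,
    fun i => ?_⟩
  simp only [Function.comp_apply]
  generalize φ i = j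
  rw [hn]
  obtain ⟨r, hr, hrq⟩ : ∃ r : ℝ, 1 ≤ r ∧ r ^ 2 = q j := ⟨√(q j), by
    rw [Real.one_le_sqrt]; exact_mod_cast (by have := hq1 j; omega : 1 ≤ q j),
    Real.sq_sqrt (by positivity)⟩
  obtain ⟨t, ht, htd⟩ : ∃ t : ℝ, 1 ≤ t ∧ t ^ 2 = d j := ⟨√(d j), by
    rw [Real.one_le_sqrt]; exact_mod_cast hd1 j, Real.sq_sqrt (by positivity)⟩
  have hsqrt : (Nat.sqrt (q j) : ℝ) ≤ r := by
    refine Real.nat_sqrt_le_real_sqrt.trans (le_of_eq ?_)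
    rw [← hrq, Real.sqrt_sq (by linarith)]
  have hdr : (d j : ℝ) ≤ r ^ 2 + 18 * r := by
    have : (d j : ℝ) ≤ q j + 8 * Nat.sqrt (q j) + 10 := by exact_mod_cast hd j
    rw [← hrq] at this
    linarith
  have hrt : r ≤ 2 * t := by
    have := hq2 j
    rw [← hrq, ← htd] at this
    refine le_of_sq_le_sq ?_ (by linarith)
    nlinarith
  have hpow : (d j : ℝ) ^ (5 / 2 : ℝ) = t ^ 5 := by
    rw [← htd, ← Real.rpow_natCast, ← Real.rpow_mul (by linarith), ← Real.rpow_natCast]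
    norm_num
  have hMj := hM j
  rw [hpow, Real.norm_eq_abs, Real.norm_of_nonneg (by positivity), abs_le]
  have ht5 : 1 ≤ t ^ 5 := one_le_pow₀ ht
  constructor
  · have hd' : (1 : ℝ) ≤ d j := by exact_mod_cast hd1 j
    nlinarith
  · have h3 : (d j : ℝ) ^ 3 ≤ (r ^ 2 + 18 * r) ^ 3 := by gcongr
    have h5 : r ^ 5 ≤ (2 * t) ^ 5 := by gcongr
    have h45 : r ^ 4 ≤ r ^ 5 := pow_le_pow_right₀ hr (by norm_num)
    have h35 : r ^ 3 ≤ r ^ 5 := pow_le_pow_right₀ hr (by norm_num)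
    rw [← hrq]
    nlinarith

theorem maxCayleyOrder_div_mooreBound_le_one (d k : ℕ) :
    (maxCayleyOrder d k : ℝ) / mooreBound d k ≤ 1 :=
  div_le_one_of_le₀ (by exact_mod_cast maxCayleyOrder_le_mooreBound d k) (by positivity)

theorem corollary1 :
    (∃ d n : ℕ → ℕ, StrictMono d ∧ (∀ i, n i ∈ cayleyOrders (d i) 3) ∧
      (fun i => (d i : ℝ) ^ 3 - (n i : ℝ)) =O[atTop] (fun i => (d i : ℝ) ^ (5 / 2 : ℝ))) ∧
    (∀ d : ℕ, BddAbove (cayleyOrders d 3)) ∧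
    limsup (fun d : ℕ => (maxCayleyOrder d 3 : ℝ) / (mooreBound d 3 : ℝ)) atTop = 1 := by
  obtain ⟨d, n, C, hmono, hmem, hC⟩ := exists_cayleyOrders_three_asymptotic
  refine ⟨⟨d, n, hmono, hmem, IsBigO.of_bound C (Eventually.of_forall hC)⟩,
    fun d => bddAbove_cayleyOrders d 3, ?_⟩
  have hbdd : IsBoundedUnder (· ≤ ·) atTop
      (fun d : ℕ => (maxCayleyOrder d 3 : ℝ) / (mooreBound d 3 : ℝ)) :=
    isBoundedUnder_of ⟨1, fun d => maxCayleyOrder_div_mooreBound_le_one d 3⟩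
  have hcobdd : IsCoboundedUnder (· ≤ ·) atTop
      (fun d : ℕ => (maxCayleyOrder d 3 : ℝ) / (mooreBound d 3 : ℝ)) :=
    (isBoundedUnder_of ⟨0, fun d => by positivity⟩ :
      IsBoundedUnder (· ≥ ·) atTop _).isCoboundedUnder_le
  refine le_antisymm (limsup_le_of_le hcobdd
    (Eventually.of_forall fun d => maxCayleyOrder_div_mooreBound_le_one d 3)) ?_
  have hlow : ∀ᶠ i in atTop, 1 - 2 * (C + 1) * ((d i : ℝ) ^ (1 / 2 : ℝ))⁻¹ ≤
      (maxCayleyOrder (d i) 3 : ℝ) / (mooreBound (d i) 3 : ℝ) := by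
    filter_upwards [hmono.tendsto_atTop.eventually_ge_atTop 1] with i hi
    have hi' : (1 : ℝ) ≤ d i := by exact_mod_cast hi
    have hle : (n i : ℝ) ≤ maxCayleyOrder (d i) 3 := by
      exact_mod_cast le_csSup (bddAbove_cayleyOrders (d i) 3) (hmem i)
    have hpow : (d i : ℝ) ^ (5 / 2 : ℝ) * (d i : ℝ) ^ (1 / 2 : ℝ) = (d i : ℝ) ^ 3 := by
      rw [← Real.rpow_add (by linarith), ← Real.rpow_natCast]
      norm_num
    have hone : 1 ≤ (d i : ℝ) ^ (5 / 2 : ℝ) := Real.one_le_rpow hi' (by norm_num)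
    have hpos : 0 < (d i : ℝ) ^ (1 / 2 : ℝ) := Real.rpow_pos_of_pos (by linarith) _
    have hCi := (Real.le_norm_self _).trans (hC i)
    rw [Real.norm_of_nonneg (by linarith : 0 ≤ (d i : ℝ) ^ (5 / 2 : ℝ))] at hCi
    have hM : (mooreBound (d i) 3 : ℝ) ≤ (d i : ℝ) ^ 3 + 1 := by
      rw [mooreBound_three_cast]
      nlinarith
    have hM' : (d i : ℝ) ^ 3 ≤ 2 * (mooreBound (d i) 3 : ℝ) := by
      rw [mooreBound_three_cast]
      nlinarith [mul_nonneg (by linarith : (0 : ℝ) ≤ d i) (sq_nonneg ((d i : ℝ) - 1))]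
    have hM0 : 0 < (mooreBound (d i) 3 : ℝ) := by
      have : 0 < (d i : ℝ) ^ 3 := by positivity
      linarith
    have hC0 : 0 ≤ C + 1 := by
      have := (norm_nonneg _).trans (hC i)
      rw [Real.norm_of_nonneg (by linarith : 0 ≤ (d i : ℝ) ^ (5 / 2 : ℝ))] at this
      nlinarith
    rw [le_div_iff₀ hM0]
    have key : (d i : ℝ) ^ (5 / 2 : ℝ) ≤
        2 * mooreBound (d i) 3 * ((d i : ℝ) ^ (1 / 2 : ℝ))⁻¹ := by
      rw [← div_eq_mul_inv, le_div_iff₀ hpos, hpow]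
      exact hM'
    nlinarith [mul_le_mul_of_nonneg_left key hC0]
  have hlim : Tendsto (fun i => 1 - 2 * (C + 1) * ((d i : ℝ) ^ (1 / 2 : ℝ))⁻¹) atTop (nhds 1) := by
    have h1 := (tendsto_rpow_atTop (by norm_num : (0 : ℝ) < 1 / 2)).comp
      (tendsto_natCast_atTop_atTop.comp hmono.tendsto_atTop)
    simpa using (h1.inv_tendsto_atTop.const_mul (2 * (C + 1))).const_sub 1
  refine le_of_forall_lt_imp_le_of_dense fun c hc => ?_
  refine le_limsup_of_frequently_le ?_ hbdd
  refine hmono.tendsto_atTop.frequently (Eventually.frequently ?_)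
  filter_upwards [hlow, hlim.eventually_const_lt hc] with i h1 h2
  exact h2.le.trans h1
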